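/- Let $\mathbb{F}_q$ be a finite field with $q$ elements, let $t\in\mathbb{N}$, and let $\mathcal{B}\subseteq\{g\colon\mathbb{F}_q^t\to\mathbb{F}_q\}$ be an affine-invariant linear code, i.e. an $\mathbb{F}_q$-linear subspace such that $g\circ T\in\mathcal{B}$ for every $g\in\mathcal{B}$ and every affine map $T\colon\mathbb{F}_q^t\to\mathbb{F}_q^t$. A $d$-flat is a $d$-dimensional affine subspace; the restriction of a function to a $d$-flat is regarded as a function on $\mathbb{F}_q^d$ through an affine parametrization of the flat (by affine invariance, the choice of parametrization does not affect the memberships below). For $n\ge t$ let \[ \mathsf{Lift}_n(\mathcal{B})=\{f\colon\mathbb{F}_q^n\to\mathbb{F}_q \;:\; f|_A\in\mathcal{B}\text{ for every } t\text{-flat } A\subseteq\mathbb{F}_q^n\}. \] Let $k\ge t$, let $f\colon\mathbb{F}_q^{k+1}\to\mathbb{F}_q$ satisfy $f\notin\mathsf{Lift}_{k+1}(\mathcal{B})$, let $\mathcal{H}$ be the set of affine hyperplanes ($k$-flats) $H\subseteq\mathbb{F}_q^{k+1}$ with $f|_H\notin\mathsf{Lift}_k(\mathcal{B})$, and let $\varepsilon_k(f)$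 be the fraction of the affine hyperplanes of $\mathbb{F}_q^{k+1}$ that belong to $\mathcal{H}$. Then: \begin{enumerate} \item $\varepsilon_k(f)\ge \frac1q$. \item If $\varepsilon_k(f)=\frac1q$ and there is a point $x^\star\in\mathbb{F}_q^{k+1}$ such that $\mathcal{H}$ is exactly the set of affine hyperplanes containing $x^\star$, then there is $g\in\mathsf{Lift}_{k+1}(\mathcal{B})$ that agrees with $f$ at every point except $x^\star$. \end{enumerate} -/

import Mathlib

namespace LiftedCode

variable {F : Type*} [Field F]

/-- `B`, a linear code of functions `F^t → F`, is affine invariant: it is closed under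
composition with affine transformations of `F^t`. -/
def IsAffineInvariant {t : ℕ} (B : Submodule F ((Fin t → F) → F)) : Prop :=
  ∀ g ∈ B, ∀ T : (Fin t → F) →ᵃ[F] (Fin t → F), g ∘ T ∈ B

/-- `A` is a `d`-flat of `F^n`: a (nonempty) affine subspace of dimension `d`. -/
def IsFlat {n : ℕ} (d : ℕ) (A : AffineSubspace F (Fin n → F)) : Prop :=
  (A : Set (Fin n → F)).Nonempty ∧ Module.finrank F A.direction = d

/-- `f|_A ∈ S`, for a `d`-flat `A` of `F^n` and a set `S` of functions on `F^d`: the restriction,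
read on `F^d` through any affine parametrization `φ` of `A`, belongs to `S`.
(For sets `S` closed under affine transformations, one `φ` or all `φ` is the same.) -/
def RestrictsInto {n d : ℕ} (f : (Fin n → F) → F) (A : AffineSubspace F (Fin n → F))
    (S : Set ((Fin d → F) → F)) : Prop :=
  ∀ φ : (Fin d → F) →ᵃ[F] (Fin n → F), Function.Injective φ →
    Set.range φ = (A : Set (Fin n → F)) → f ∘ φ ∈ S

/-- The `n`-lift of `B`: the functions on `F^n` whose restriction to every `t`-flat is in `B`. -/
def lift {t : ℕ} (B : Submodule F ((Fin t → F) → F)) (n : ℕ) : Set ((Fin n → F) → F) :=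
  {f | ∀ A : AffineSubspace F (Fin n → F), IsFlat t A →
    RestrictsInto f A (B : Set ((Fin t → F) → F))}

/-- The `k`-flats on which the `k`-flat tester rejects `f`: those with `f|_A ∉ Lift_k(B)`. -/
def badFlats {t n : ℕ} (B : Submodule F ((Fin t → F) → F)) (k : ℕ) (f : (Fin n → F) → F) :
    Set (AffineSubspace F (Fin n → F)) :=
  {A | IsFlat k A ∧ ¬ RestrictsInto f A (lift B k)}

/-- The probability that the `k`-flat tester rejects `f`, for a uniformly random `k`-flat. -/
noncomputable def rejectProb {t n : ℕ} (B : Submodule F ((Fin t → F) → F)) (k : ℕ)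
    (f : (Fin n → F) → F) : ℚ :=
  ((badFlats B k f).ncard : ℚ) / ({A : AffineSubspace F (Fin n → F) | IsFlat k A}.ncard : ℚ)

end LiftedCode

namespace LiftedCode

variable {F : Type*} [Field F]

/-! Write `q` for `|F|` and `C` for the affine-invariant code `liftCode B k`; being in the lift
means that every hyperplane restriction is in `C`. Bound: fix a direction `v`. Some bad hyperplane
is transversal to `v` (`forall_comp_mem_of_forall_transversal`), so after a change of coordinates it
is the graph of an affine functional. A linear form vanishing on `C` but not on that restriction is,
as a function of the graph's `k + 1` coefficients, a nonzero polynomial of degree at most `q - 1`.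
By Schwartz–Zippel it is nonzero on at least a `1/q` fraction of graphs
(`card_pow_le_card_graph_notMem`), all of them bad. Averaging over affine automorphisms gives the
bound for all hyperplanes. Correction: if all hyperplanes missing `x` are good, then one hyperplane
through `x` becomes good after a change of value at `x` alone (`exists_sub_single_mem`). The
corrected function has strictly fewer bad hyperplanes, hence rejection probability below `1/q`, so
by the bound it lies in the lift. -/

/-! ### Affine parametrizations of flats -/

theorem exists_submodule_ge_finrank_eq {V : Type*} [AddCommGroup V] [Module F V]
    [FiniteDimensional F V] (W : Submodule F V) {m : ℕ} (hW : Module.finrank F W ≤ m)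
    (hm : m ≤ Module.finrank F V) : ∃ W' : Submodule F V, W ≤ W' ∧ Module.finrank F W' = m := by
  induction m, hW using Nat.le_induction with
  | base => exact ⟨W, le_rfl, rfl⟩
  | succ m _ ih =>
    obtain ⟨W', hle, hrank⟩ := ih (by omega)
    have hne : W' < ⊤ := lt_top_iff_ne_top.2 fun h => by
      rw [h, finrank_top] at hrank; omega
    obtain ⟨v, -, hv⟩ := SetLike.exists_of_lt hne
    refine ⟨W' ⊔ Submodule.span F {v}, hle.trans le_sup_left, ?_⟩
    rw [Submodule.finrank_sup_span_singleton hv, hrank]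

/-- Every affine map `F^s → F^n` factors through an injective affine map `F^m → F^n`, as long as
`s ≤ m ≤ n`. -/
theorem exists_injective_factor {s m n : ℕ} (hsm : s ≤ m) (hmn : m ≤ n)
    (α : (Fin s → F) →ᵃ[F] (Fin n → F)) :
    ∃ ψ : (Fin m → F) →ᵃ[F] (Fin n → F), Function.Injective ψ ∧
      ∃ β : (Fin s → F) →ᵃ[F] (Fin m → F), α = ψ.comp β := by
  obtain ⟨W, hle, hW⟩ := exists_submodule_ge_finrank_eq (LinearMap.range α.linear) (m := m)
    ((LinearMap.finrank_range_le _).trans (by simpa using hsm)) (by simpa using hmn)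
  let e : W ≃ₗ[F] (Fin m → F) := LinearEquiv.ofFinrankEq _ _ (by simpa using hW)
  let L : (Fin s → F) →ₗ[F] W := α.linear.codRestrict W fun x => hle ⟨x, rfl⟩
  refine ⟨(W.subtype ∘ₗ e.symm.toLinearMap).toAffineMap + AffineMap.const F _ (α 0), ?_,
    (e.toLinearMap ∘ₗ L).toAffineMap, ?_⟩
  · intro x y hxy
    simpa using hxy
  · ext1 x
    have := congrFun α.decomp x
    simp only [Pi.add_apply] at this
    simp [L, this]

theorem direction_map_top {d n : ℕ} (φ : (Fin d → F) →ᵃ[F] (Fin n → F)) :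
    ((⊤ : AffineSubspace F (Fin d → F)).map φ).direction = LinearMap.range φ.linear := by
  rw [AffineSubspace.map_direction, AffineSubspace.direction_top, Submodule.map_top]

theorem isFlat_map_top {d n : ℕ} {φ : (Fin d → F) →ᵃ[F] (Fin n → F)}
    (hφ : Function.Injective φ) : IsFlat d ((⊤ : AffineSubspace F (Fin d → F)).map φ) := by
  refine ⟨⟨φ 0, 0, trivial, rfl⟩, ?_⟩
  rw [direction_map_top, LinearMap.finrank_range_of_inj (φ.linear_injective_iff.2 hφ)]
  simp

theorem IsFlat.exists_eq_map_top {d n : ℕ} {A : AffineSubspace F (Fin n → F)} (hA : IsFlat d A) :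
    ∃ φ : (Fin d → F) →ᵃ[F] (Fin n → F), Function.Injective φ ∧
      (⊤ : AffineSubspace F (Fin d → F)).map φ = A := by
  obtain ⟨⟨p, hp⟩, hd⟩ := hA
  let e : (Fin d → F) ≃ₗ[F] A.direction := LinearEquiv.ofFinrankEq _ _ (by simpa using hd.symm)
  let φ : (Fin d → F) →ᵃ[F] (Fin n → F) :=
    (A.direction.subtype ∘ₗ e.toLinearMap).toAffineMap + AffineMap.const F _ p
  have hlin : φ.linear = A.direction.subtype ∘ₗ e.toLinearMap := by
    ext1; simp [φ]
  refine ⟨φ, fun x y hxy => by simpa [φ] using hxy, ?_⟩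
  refine AffineSubspace.ext_of_direction_eq ?_ ⟨p, ⟨0, trivial, by simp [φ]⟩, hp⟩
  rw [direction_map_top, hlin, LinearMap.range_comp, LinearEquiv.range, Submodule.map_top,
    Submodule.range_subtype]

/-- Two affine parametrizations of the same flat differ by an affine map of the parameter space. -/
theorem exists_eq_comp_of_range_subset {d s n : ℕ} {φ : (Fin d → F) →ᵃ[F] (Fin n → F)}
    {ψ : (Fin s → F) →ᵃ[F] (Fin n → F)} (hψ : Function.Injective ψ)
    (h : Set.range φ ⊆ Set.range ψ) :
    ∃ T : (Fin d → F) →ᵃ[F] (Fin s → F), φ = ψ.comp T := by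
  obtain ⟨π, hπ⟩ := ψ.linear.exists_leftInverse_of_injective
    (LinearMap.ker_eq_bot.2 (ψ.linear_injective_iff.2 hψ))
  have hπ' : ∀ z, π (ψ.linear z) = z := fun z => LinearMap.congr_fun hπ z
  refine ⟨π.toAffineMap.comp (φ - AffineMap.const F _ (ψ 0)), ?_⟩
  ext1 x
  obtain ⟨z, hz⟩ := h ⟨x, rfl⟩
  have := congrFun ψ.decomp z
  simp only [Pi.add_apply] at this
  have hz' : φ x - ψ 0 = ψ.linear z := by rw [← hz, this]; simp
  simp [← map_sub, hz', hπ', hz]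

/-! ### Lifts as affine-invariant linear codes -/

/-- Membership in a lift, tested on all affine maps, degenerate ones included. -/
theorem mem_lift_iff {t n : ℕ} (htn : t ≤ n) {B : Submodule F ((Fin t → F) → F)}
    (hB : IsAffineInvariant B) {f : (Fin n → F) → F} :
    f ∈ lift B n ↔ ∀ φ : (Fin t → F) →ᵃ[F] (Fin n → F), f ∘ φ ∈ B := by
  refine ⟨fun hf φ => ?_, fun hf A _ φ _ _ => hf φ⟩
  obtain ⟨ψ, hψ, β, rfl⟩ := exists_injective_factor le_rfl htn φ
  exact hB _ (hf _ (isFlat_map_top hψ) ψ hψ (by simp)) β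

/-- The lift of a code as a linear code. -/
def liftCode {t : ℕ} (B : Submodule F ((Fin t → F) → F)) (n : ℕ) :
    Submodule F ((Fin n → F) → F) where
  carrier := lift B n
  zero_mem' := fun _ _ _ _ _ => B.zero_mem
  add_mem' := fun hf hg A hA φ h₁ h₂ => B.add_mem (hf A hA φ h₁ h₂) (hg A hA φ h₁ h₂)
  smul_mem' := fun c _ hf A hA φ h₁ h₂ => B.smul_mem c (hf A hA φ h₁ h₂)

theorem isAffineInvariant_liftCode {t n : ℕ} (htn : t ≤ n) {B : Submodule F ((Fin t → F) → F)}
    (hB : IsAffineInvariant B) : IsAffineInvariant (liftCode B n) := by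
  intro g hg T
  exact (mem_lift_iff htn hB).2 fun φ => (mem_lift_iff htn hB).1 hg (T.comp φ)

/-- `Lift_n(B)` is the lift of `Lift_m(B)`. -/
theorem mem_lift_iff_forall_comp_mem_liftCode {t m n : ℕ} (htm : t ≤ m) (hmn : m ≤ n)
    {B : Submodule F ((Fin t → F) → F)} (hB : IsAffineInvariant B) {f : (Fin n → F) → F} :
    f ∈ lift B n ↔ ∀ φ : (Fin m → F) →ᵃ[F] (Fin n → F), Function.Injective φ →
      f ∘ φ ∈ liftCode B m := by
  constructor
  · intro hf φ _
    exact (mem_lift_iff htm hB).2 fun ψ => (mem_lift_iff (htm.trans hmn) hB).1 hf (φ.comp ψ)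
  · intro hf
    refine (mem_lift_iff (htm.trans hmn) hB).2 fun α => ?_
    obtain ⟨ψ, hψ, β, rfl⟩ := exists_injective_factor htm hmn α
    exact (mem_lift_iff htm hB).1 (hf ψ hψ) β

theorem restrictsInto_map_top_iff {d n : ℕ} {C : Submodule F ((Fin d → F) → F)}
    (hC : IsAffineInvariant C) {f : (Fin n → F) → F} {φ : (Fin d → F) →ᵃ[F] (Fin n → F)}
    (hφ : Function.Injective φ) :
    RestrictsInto f ((⊤ : AffineSubspace F (Fin d → F)).map φ) (C : Set ((Fin d → F) → F)) ↔
      f ∘ φ ∈ C := by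
  refine ⟨fun h => h φ hφ (by simp), fun h ψ _ hr => ?_⟩
  obtain ⟨T, rfl⟩ := exists_eq_comp_of_range_subset (φ := ψ) hφ (by rw [hr]; simp)
  exact hC _ h T

/-! ### Bad hyperplanes transversal to a given direction -/

/-- For `r = 0` one value is added `q` times, which is zero in `F`. Thus summing over dilations
produces the cutoff to `r ≠ 0`. -/
theorem sum_smul_eq_ite [Fintype F] [DecidableEq F] (h : F → F) (r : F) :
    ∑ s, h (s * r) = if r = 0 then 0 else ∑ x, h x := by
  split_ifs with hr
  · simp [hr]
  · exact Equiv.sum_comp (Equiv.mulRight₀ r hr) h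

/-- The hyperplanes on which a function violates an affine-invariant code do not all contain a
common direction. -/
theorem forall_comp_mem_of_forall_transversal [Fintype F] {k n : ℕ}
    {C : Submodule F ((Fin k → F) → F)} (hC : IsAffineInvariant C) (hkn : k < n)
    {f : (Fin n → F) → F} {v : Fin n → F} (hv : v ≠ 0)
    (hf : ∀ φ : (Fin k → F) →ᵃ[F] (Fin n → F), Function.Injective φ →
      v ∉ LinearMap.range φ.linear → f ∘ φ ∈ C)
    (φ : (Fin k → F) →ᵃ[F] (Fin n → F)) (hφ : Function.Injective φ) : f ∘ φ ∈ C := by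
  classical
  by_cases hmem : v ∈ LinearMap.range φ.linear
  swap
  · exact hf φ hφ hmem
  obtain ⟨y₀, hy₀⟩ := hmem
  have hy₀0 : y₀ ≠ 0 := by rintro rfl; exact hv (by simpa using hy₀.symm)
  obtain ⟨p, hp⟩ := Module.Projective.exists_dual_eq_one F hy₀0
  have hlt : LinearMap.range φ.linear < ⊤ := lt_top_iff_ne_top.2 fun h => by
    have := LinearMap.finrank_range_le φ.linear
    rw [h, finrank_top] at this
    simp at this
    omega
  obtain ⟨u, -, hu⟩ := SetLike.exists_of_lt hlt
  have hφl : Function.Injective φ.linear := φ.linear_injective_iff.2 hφ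
  have hind : ∀ (y : Fin k → F) (r : F), φ.linear y + r • u ∈ LinearMap.range φ.linear →
      r = 0 := by
    intro y r hr
    by_contra hr0
    refine hu ?_
    have h1 : r • u ∈ LinearMap.range φ.linear := by
      simpa using Submodule.sub_mem _ hr ⟨y, rfl⟩
    simpa [smul_smul, hr0] using Submodule.smul_mem _ r⁻¹ h1
  -- the projection along `y₀` onto the kernel of `p`
  let P : (Fin k → F) →ₗ[F] (Fin k → F) := LinearMap.id - p.smulRight y₀
  have hP : ∀ y, P y = y - p y • y₀ := fun y => by simp [P]
  have hpP : ∀ y, p (P y) = 0 := fun y => by simp [hP, hp]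
  -- Tilting towards `u` loses `v`: its preimage would have to be `y₀`, where the tilt `s * p y₀ =
  -- s` is nonzero.
  have htilt : ∀ s c : F, s ≠ 0 → (fun y => f (φ y + (s * p y + c) • u)) ∈ C := by
    intro s c hs
    let ψ : (Fin k → F) →ᵃ[F] (Fin n → F) :=
      φ + (((s • p).smulRight u).toAffineMap + AffineMap.const F _ (c • u))
    have hψl : ∀ y, ψ.linear y = φ.linear y + (s * p y) • u := fun y => by simp [ψ]
    have hψ : Function.Injective ψ := by
      rw [← ψ.linear_injective_iff, injective_iff_map_eq_zero]
      intro y hy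
      rw [hψl] at hy
      have h0 := hind y _ (hy ▸ Submodule.zero_mem _)
      rw [h0] at hy
      exact (injective_iff_map_eq_zero _).1 hφl y (by simpa using hy)
    have hv' : v ∉ LinearMap.range ψ.linear := by
      rintro ⟨y, hy⟩
      rw [hψl] at hy
      have h0 := hind y _ (by rw [hy]; exact ⟨y₀, hy₀⟩)
      rw [h0, ← hy₀] at hy
      have : y = y₀ := hφl (by simpa using hy)
      subst this
      exact hs (by simpa [hp] using h0)
    convert hf ψ hψ hv' using 1
    funext y
    simp [ψ, add_smul]
  -- The hyperplane in which `u` replaces the direction `v = φ.linear y₀`.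
  have hswap : (fun y => f (φ (P y) + p y • u)) ∈ C := by
    let ψ : (Fin k → F) →ᵃ[F] (Fin n → F) := φ.comp P.toAffineMap + (p.smulRight u).toAffineMap
    have hψl : ∀ y, ψ.linear y = φ.linear (P y) + p y • u := fun y => by simp [ψ]
    have hψ : Function.Injective ψ := by
      rw [← ψ.linear_injective_iff, injective_iff_map_eq_zero]
      intro y hy
      rw [hψl] at hy
      have h0 := hind _ _ (hy ▸ Submodule.zero_mem _)
      rw [h0] at hy
      have := (injective_iff_map_eq_zero _).1 hφl _ (by simpa using hy)
      simpa [hP, h0] using this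
    have hv' : v ∉ LinearMap.range ψ.linear := by
      rintro ⟨y, hy⟩
      rw [hψl] at hy
      have h0 := hind _ _ (by rw [hy]; exact ⟨y₀, hy₀⟩)
      rw [h0, ← hy₀] at hy
      have : P y = y₀ := hφl (by simpa using hy)
      have h1 := hpP y
      rw [this, hp] at h1
      exact one_ne_zero h1
    convert hf ψ hψ hv' using 1
    funext y
    simp [ψ]
  -- Sums along the lines in direction `u`; it equals the sum over all `c` of the tilts with `s =
  -- 1`.
  let S : (Fin k → F) → F := fun y => ∑ x : F, f (φ y + x • u)
  have hS : S ∈ C := by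
    have := C.sum_mem (t := Finset.univ) fun (c : F) _ => htilt 1 c one_ne_zero
    convert this using 1
    funext y
    rw [Finset.sum_apply]
    simp only [one_mul, S]
    exact (Equiv.sum_comp (Equiv.addLeft (p y)) fun x => f (φ y + x • u)).symm
  have hSP : (fun y => S (P y)) ∈ C := hC S hS P.toAffineMap
  -- Dilate the `y₀`-coordinate in `hswap` by `c` and sum over `c`.
  have hcut : (fun y => if p y = 0 then 0 else S (P y)) ∈ C := by
    have := C.sum_mem (t := Finset.univ) fun (c : F) _ =>
      hC _ hswap (P + c • p.smulRight y₀).toAffineMap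
    convert this using 1
    funext y
    rw [Finset.sum_apply, ← sum_smul_eq_ite (fun x => f (φ (P y) + x • u))]
    refine Finset.sum_congr rfl fun c _ => ?_
    have h1 : p ((P + c • p.smulRight y₀) y) = c * p y := by simp [hpP, hp]
    have h2 : P ((P + c • p.smulRight y₀) y) = P y := by
      rw [hP ((P + c • p.smulRight y₀) y), h1]; simp [mul_smul]
    simp only [Function.comp_apply, LinearMap.coe_toAffineMap, h1, h2]
  have hrest : (fun y => ∑ s ∈ Finset.univ.erase 0, f (φ y + (s * p y) • u)) ∈ C := by
    have := C.sum_mem (t := Finset.univ.erase (0 : F)) fun s hs =>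
      htilt s 0 (Finset.ne_of_mem_erase hs)
    convert this using 1
    funext y
    simp
  -- The sum of `f (φ y + (s * p y) • u)` over all `s` is `[p y ≠ 0] S y`, which equals `S y - S (P
  -- y) + [p y ≠ 0] S (P y)` because `P y = y` when `p y = 0`. Removing the terms `s ≠ 0` isolates
  -- `f (φ y)`.
  have hsum := C.sub_mem (C.add_mem (C.sub_mem hS hSP) hcut) hrest
  convert hsum using 1
  funext y
  have h1 := sum_smul_eq_ite (fun x => f (φ y + x • u)) (p y)
  rw [← Finset.add_sum_erase _ _ (Finset.mem_univ (0 : F))] at h1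
  simp only [zero_mul, zero_smul, add_zero] at h1
  simp only [Pi.add_apply, Pi.sub_apply, Function.comp_apply]
  rw [eq_sub_iff_add_eq, h1]
  split_ifs with h0
  · simp [hP, h0]
  · simp [S]

/-! ### Splitting off the first coordinate -/

/-- The affine map `x ↦ (α x, T x)`, the first component being prepended as a coordinate. -/
def consMap {m k : ℕ} (α : (Fin m → F) →ᵃ[F] F) (T : (Fin m → F) →ᵃ[F] (Fin k → F)) :
    (Fin m → F) →ᵃ[F] (Fin (k + 1) → F) :=
  (Fin.consLinearEquiv F fun _ : Fin (k + 1) => F).toLinearMap.toAffineMap.comp (α.prod T)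

@[simp]
theorem consMap_apply {m k : ℕ} (α : (Fin m → F) →ᵃ[F] F) (T : (Fin m → F) →ᵃ[F] (Fin k → F))
    (x : Fin m → F) : consMap α T x = Fin.cons (α x) (T x) := rfl

/-- The affine map forgetting the first coordinate. -/
def tailMap (F : Type*) [Field F] (k : ℕ) : (Fin (k + 1) → F) →ᵃ[F] (Fin k → F) :=
  (LinearMap.funLeft F F Fin.succ).toAffineMap

@[simp]
theorem tailMap_apply {k : ℕ} (x : Fin (k + 1) → F) : tailMap F k x = Fin.tail x := rfl

/-- The affine map reading off the first coordinate. -/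
def headMap (F : Type*) [Field F] (k : ℕ) : (Fin (k + 1) → F) →ᵃ[F] F :=
  (LinearMap.proj 0 : (Fin (k + 1) → F) →ₗ[F] F).toAffineMap

@[simp]
theorem headMap_apply {k : ℕ} (x : Fin (k + 1) → F) : headMap F k x = x 0 := rfl

/-- The parametrization of the hyperplane on which the first coordinate is `c`. -/
def levelMap (k : ℕ) (c : F) : (Fin k → F) →ᵃ[F] (Fin (k + 1) → F) :=
  consMap (AffineMap.const F _ c) (AffineMap.id F _)

@[simp]
theorem levelMap_apply {k : ℕ} (c : F) (y : Fin k → F) : levelMap k c y = Fin.cons c y := rfl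

theorem levelMap_injective {k : ℕ} (c : F) : Function.Injective (levelMap (F := F) k c) :=
  fun _ _ h => Fin.cons_right_injective (α := fun _ => F) c h

/-! ### Correcting a hyperplane restriction at one point -/

section Defect

variable [DecidableEq F]

/-- The code of those `g` on `F^k` for which `y ↦ [y₀ ≠ 0] g(y₁, …, y_k)` belongs to `C`. -/
def headCut {k : ℕ} (C : Submodule F ((Fin (k + 1) → F) → F)) :
    Submodule F ((Fin k → F) → F) where
  carrier := {g | (fun y : Fin (k + 1) → F => if y 0 = 0 then 0 else g (Fin.tail y)) ∈ C}
  zero_mem' := by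
    rw [Set.mem_ofPred_eq]
    convert C.zero_mem using 1
    funext y
    simp
  add_mem' := fun {g h} hg hh => by
    simp only [Set.mem_ofPred_eq] at *
    convert C.add_mem hg hh using 1
    funext y
    by_cases hy : y 0 = 0 <;> simp [hy]
  smul_mem' := fun c g hg => by
    simp only [Set.mem_ofPred_eq] at *
    convert C.smul_mem c hg using 1
    funext y
    by_cases hy : y 0 = 0 <;> simp [hy]

theorem mem_headCut {k : ℕ} {C : Submodule F ((Fin (k + 1) → F) → F)} {g : (Fin k → F) → F} :
    g ∈ headCut C ↔
      (fun y : Fin (k + 1) → F => if y 0 = 0 then 0 else g (Fin.tail y)) ∈ C := Iff.rfl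

theorem isAffineInvariant_headCut {k : ℕ} {C : Submodule F ((Fin (k + 1) → F) → F)}
    (hC : IsAffineInvariant C) : IsAffineInvariant (headCut C) := by
  intro g hg T
  rw [mem_headCut] at *
  convert hC _ hg (consMap (headMap F k) (T.comp (tailMap F k))) using 1
  funext y
  simp

/-- If `g ∈ headCut C`, then `g` placed on any level of the first coordinate is in `C`. -/
theorem level_mem_of_mem_headCut [Fintype F] {k : ℕ} {C : Submodule F ((Fin (k + 1) → F) → F)}
    (hC : IsAffineInvariant C) {g : (Fin k → F) → F} (hg : g ∈ headCut C) (a : F) :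
    (fun y : Fin (k + 1) → F => if y 0 = a then g (Fin.tail y) else 0) ∈ C := by
  rw [mem_headCut] at hg
  have htrans : ∀ a : F,
      (fun y : Fin (k + 1) → F => if y 0 = a then 0 else g (Fin.tail y)) ∈ C := by
    intro a
    convert hC _ hg (consMap (headMap F k - AffineMap.const F _ a) (tailMap F k)) using 1
    funext y
    simp [sub_eq_zero]
  -- Each point is omitted by exactly one level, so the sum is `(q - 1) g = -g`; this puts `g`
  -- itself, as a function of the tail, in `C`.
  have hsum := C.sum_mem (t := Finset.univ) fun a _ => htrans a
  have := C.sub_mem (C.neg_mem hsum) (htrans a)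
  convert this using 1
  funext y
  have h1 : ∑ b : F, (if y 0 = b then 0 else g (Fin.tail y)) = - g (Fin.tail y) := by
    have h2 : ∀ b : F, (if y 0 = b then 0 else g (Fin.tail y)) =
        g (Fin.tail y) - if y 0 = b then g (Fin.tail y) else 0 := fun b => by split_ifs <;> simp
    simp [h2]
  simp only [Pi.sub_apply, Pi.neg_apply, Finset.sum_apply, h1]
  split_ifs <;> simp

/-- If a function respects an affine-invariant code on all hyperplanes avoiding the origin, then on
the hyperplane of vanishing first coordinate it does so up to its value at the origin. -/
theorem exists_sub_single_mem [Fintype F] {k : ℕ} {C : Submodule F ((Fin k → F) → F)}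
    (hC : IsAffineInvariant C) {f : (Fin (k + 1) → F) → F}
    (hf : ∀ φ : (Fin k → F) →ᵃ[F] (Fin (k + 1) → F), Function.Injective φ →
      0 ∉ Set.range φ → f ∘ φ ∈ C) :
    ∃ c : F, f ∘ levelMap k (0 : F) - Pi.single 0 c ∈ C := by
  induction k with
  | zero =>
    refine ⟨f (levelMap 0 (0 : F) 0), ?_⟩
    convert C.zero_mem using 1
    funext y
    obtain rfl : y = 0 := Subsingleton.elim _ _
    simp
  | succ k ih =>
    have hlevel : ∀ {m : ℕ} {c : F}, c ≠ 0 → (0 : Fin (m + 1) → F) ∉ Set.range (levelMap m c) := by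
      rintro m c hc ⟨y, hy⟩
      exact hc (by simpa using congrFun hy 0)
    let S : (Fin (k + 1) → F) → F := fun y => ∑ z : F, f (Fin.cons z y)
    -- The difference is minus the sum of the levels `c ≠ 0`, which miss the origin.
    have hS : f ∘ levelMap (k + 1) (0 : F) - S ∈ C := by
      have := C.neg_mem (C.sum_mem (t := Finset.univ.erase (0 : F)) fun c hc =>
        hf (levelMap (k + 1) c) (levelMap_injective c) (hlevel (Finset.ne_of_mem_erase hc)))
      convert this using 1
      funext y
      simp only [S, Pi.sub_apply, Pi.neg_apply, Finset.sum_apply, Function.comp_apply,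
        levelMap_apply]
      rw [← Finset.add_sum_erase _ _ (Finset.mem_univ (0 : F))]
      ring
    -- The product of the first axis with the range of `ψ` also misses the origin. Summing over
    -- dilations of that axis gives `[y₀ ≠ 0] S (ψ (tail y))`, so the induction hypothesis applies
    -- to `S` and `headCut C`.
    have hSψ : ∀ ψ : (Fin k → F) →ᵃ[F] (Fin (k + 1) → F), Function.Injective ψ →
        0 ∉ Set.range ψ → S ∘ ψ ∈ headCut C := by
      intro ψ hψ h0
      have hmem := hf (consMap (headMap F k) (ψ.comp (tailMap F k))) (by
          intro x y hxy
          have h := Fin.cons_injective2 (α := fun _ => F) hxy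
          rw [← Fin.cons_self_tail x, ← Fin.cons_self_tail y]
          exact congrArg₂ _ h.1 (hψ h.2)) (by
          rintro ⟨y, hy⟩
          exact h0 ⟨Fin.tail y, by
            have := congrArg Fin.tail hy
            exact this⟩)
      have := C.sum_mem (t := Finset.univ) fun (s : F) _ =>
        hC _ hmem (consMap (s • headMap F k) (tailMap F k))
      rw [mem_headCut]
      convert this using 1
      funext y
      have h := sum_smul_eq_ite (fun z => f (Fin.cons z (ψ (Fin.tail y)))) (y 0)
      simp only [Function.comp_apply, S, ← h, Finset.sum_apply, consMap_apply, headMap_apply,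
        AffineMap.comp_apply, tailMap_apply, Fin.tail_cons, Fin.cons_zero]
      rfl
    obtain ⟨c, hc⟩ := ih (isAffineInvariant_headCut hC) hSψ
    refine ⟨c, ?_⟩
    -- Reassemble `S` from its levels: those with `a ≠ 0` miss the origin and need no correction;
    -- level `0` is corrected at the origin.
    have hslices := C.add_mem (level_mem_of_mem_headCut hC hc 0)
      (C.sum_mem (t := Finset.univ.erase (0 : F)) fun a ha => level_mem_of_mem_headCut hC
        (hSψ (levelMap k a) (levelMap_injective a) (hlevel (Finset.ne_of_mem_erase ha))) a)
    convert C.add_mem hS hslices using 1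
    funext y
    have hsplit : S y = ∑ a : F, if y 0 = a then S (Fin.cons a (Fin.tail y)) else 0 := by
      simp
    rw [← Finset.add_sum_erase _ _ (Finset.mem_univ (0 : F))] at hsplit
    have hsingle : (Pi.single 0 c : (Fin (k + 1) → F) → F) y =
        if y 0 = 0 then (Pi.single 0 c : (Fin k → F) → F) (Fin.tail y) else 0 := by
      have : y = 0 ↔ y 0 = 0 ∧ Fin.tail y = 0 := by
        constructor
        · rintro rfl; exact ⟨rfl, rfl⟩
        · rintro ⟨h0, h1⟩
          rw [← Fin.cons_self_tail y, h0, h1]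
          exact funext (Fin.cases rfl fun _ => rfl)
      simp only [Pi.single_apply, this]
      split_ifs <;> simp_all
    simp only [Pi.add_apply, Pi.sub_apply, Finset.sum_apply, Function.comp_apply, levelMap_apply,
      hsingle]
    rw [hsplit]
    split_ifs <;> ring

end Defect

/-! ### Graphs of affine functionals and Schwartz–Zippel -/

/-- The affine functional `y ↦ u₀ + u₁ y₀ + ⋯ + u_k y_{k-1}`. -/
def affineForm {k : ℕ} (u : Fin (k + 1) → F) : (Fin k → F) →ᵃ[F] F :=
  AffineMap.const F _ (u 0) + (∑ i : Fin k, u i.succ • LinearMap.proj i).toAffineMap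

@[simp]
theorem affineForm_apply {k : ℕ} (u : Fin (k + 1) → F) (y : Fin k → F) :
    affineForm u y = u 0 + ∑ i : Fin k, u i.succ * y i := by
  simp [affineForm]

theorem exists_eq_affineForm {k : ℕ} (α : (Fin k → F) →ᵃ[F] F) : ∃ u, α = affineForm u := by
  refine ⟨Fin.cons (α 0) fun i => α.linear fun j => if i = j then 1 else 0, ?_⟩
  ext1 y
  have := congrFun α.decomp y
  simp only [Pi.add_apply] at this
  rw [this, LinearMap.pi_apply_eq_sum_univ α.linear y, affineForm_apply]
  simp [add_comm, mul_comm]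

/-- The graph of an affine functional, as a hyperplane. -/
def graphMap {k : ℕ} (u : Fin (k + 1) → F) : (Fin k → F) →ᵃ[F] (Fin (k + 1) → F) :=
  consMap (affineForm u) (AffineMap.id F _)

@[simp]
theorem graphMap_apply {k : ℕ} (u : Fin (k + 1) → F) (y : Fin k → F) :
    graphMap u y = Fin.cons (affineForm u y) y := rfl

open MvPolynomial in
/-- The sum of the values of a function over a graph, with weights `w`, is a polynomial of degree
less than `|F|` in the coefficients of the graph. -/
theorem exists_mvPolynomial_eval_eq [Fintype F] {k : ℕ} (f : (Fin (k + 1) → F) → F)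
    (w : (Fin k → F) → F) :
    ∃ p : MvPolynomial (Fin (k + 1)) F, p.totalDegree ≤ Fintype.card F - 1 ∧
      ∀ u, eval u p = ∑ y, f (graphMap u y) * w y := by
  classical
  let l : (Fin k → F) → MvPolynomial (Fin (k + 1)) F := fun y =>
    X 0 + ∑ i : Fin k, X i.succ * C (y i)
  have hl : ∀ y u, eval u (l y) = affineForm u y := fun y u => by simp [l]
  have hldeg : ∀ y, (l y).totalDegree ≤ 1 := fun y => by
    refine (totalDegree_add _ _).trans (max_le (totalDegree_X _).le ?_)
    refine totalDegree_finsetSum_le fun i _ => ?_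
    refine (totalDegree_mul _ _).trans ?_
    simp
  -- By Fermat, `1 - (l y - a) ^ (q - 1)` is the indicator of `l y = a`.
  refine ⟨∑ y, ∑ a : F, C (f (Fin.cons a y) * w y) * (1 - (l y - C a) ^ (Fintype.card F - 1)),
    ?_, fun u => ?_⟩
  · refine totalDegree_finsetSum_le fun y _ => totalDegree_finsetSum_le fun a _ => ?_
    refine (totalDegree_mul _ _).trans ?_
    rw [totalDegree_C, zero_add]
    refine (totalDegree_sub _ _).trans (max_le (by simp) ?_)
    refine (totalDegree_pow _ _).trans ?_
    have : (l y - C a).totalDegree ≤ 1 :=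
      (totalDegree_sub _ _).trans (max_le (hldeg y) (by simp))
    simpa using Nat.mul_le_mul_left (Fintype.card F - 1) this
  · simp only [map_sum, map_mul, eval_C, map_sub, map_one, map_pow, hl]
    refine Finset.sum_congr rfl fun y _ => ?_
    rw [Finset.sum_eq_single (affineForm u y)]
    -- A zero exponent would give `0 ^ 0 = 1` and destroy the indicator.
    · have : Fintype.card F - 1 ≠ 0 := by
        have := Fintype.one_lt_card (α := F); omega
      simp [this]
    · intro a _ ha
      rw [FiniteField.pow_card_sub_one_eq_one _ (sub_ne_zero.2 ha.symm)]
      simp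
    · simp

open MvPolynomial in
/-- If one graph of an affine functional violates the code, then at least a `1 / |F|` fraction
of them do. -/
theorem card_pow_le_card_graph_notMem [Fintype F] {k : ℕ} {D : Submodule F ((Fin k → F) → F)}
    {f : (Fin (k + 1) → F) → F} {u₀ : Fin (k + 1) → F} (h : f ∘ graphMap u₀ ∉ D) :
    Fintype.card F ^ k ≤ Nat.card {u : Fin (k + 1) → F // f ∘ graphMap u ∉ D} := by
  classical
  -- `ℓ` vanishes on `D` but not at the bad graph; its values on point masses serve as weights.
  obtain ⟨ℓ, hℓ, hD⟩ := Submodule.exists_le_ker_of_notMem h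
  obtain ⟨p, hdeg, hp⟩ := exists_mvPolynomial_eval_eq f fun y => ℓ (Pi.single y 1)
  have hpℓ : ∀ u, eval u p = ℓ (f ∘ graphMap u) := fun u => by
    rw [hp, LinearMap.pi_apply_eq_sum_univ ℓ]
    refine Finset.sum_congr rfl fun y _ => ?_
    simp only [Function.comp_apply, smul_eq_mul]
    congr 2
    funext z
    simp [Pi.single_apply, eq_comm]
  have hp0 : p ≠ 0 := by
    rintro rfl
    exact hℓ (by rw [← hpℓ, map_zero])
  have hq : 0 < Fintype.card F := Fintype.card_pos
  have hSZ := schwartz_zippel_totalDegree hp0 (Finset.univ : Finset F)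
  rw [Fintype.piFinset_univ, Finset.card_univ, div_le_div_iff₀ (by positivity) (by positivity)]
    at hSZ
  have hzero : (Finset.univ.filter fun u => eval u p = 0).card ≤
      (Fintype.card F - 1) * Fintype.card F ^ k := by
    have h1 : (Finset.univ.filter fun u => eval u p = 0).card * Fintype.card F ≤
        p.totalDegree * Fintype.card F ^ (k + 1) := by exact_mod_cast hSZ
    refine Nat.le_of_mul_le_mul_right ?_ hq
    calc _ ≤ p.totalDegree * Fintype.card F ^ (k + 1) := h1
      _ ≤ (Fintype.card F - 1) * Fintype.card F ^ (k + 1) := Nat.mul_le_mul_right _ hdeg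
      _ = _ := by ring
  have hsplit := Finset.card_filter_add_card_filter_not (s := Finset.univ)
    (fun u : Fin (k + 1) → F => eval u p = 0)
  have hle : (Finset.univ.filter fun u => ¬ eval u p = 0).card ≤
      Nat.card {u : Fin (k + 1) → F // f ∘ graphMap u ∉ D} := by
    rw [Nat.card_eq_fintype_card, Fintype.card_subtype]
    refine Finset.card_le_card fun u hu => ?_
    simp only [Finset.mem_filter, Finset.mem_univ, true_and] at hu ⊢
    intro hmem
    exact hu (by rw [hpℓ]; exact hD hmem)
  have hcard : (Finset.univ : Finset (Fin (k + 1) → F)).card =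
      (Fintype.card F - 1) * Fintype.card F ^ k + Fintype.card F ^ k := by
    rw [Finset.card_univ, Fintype.card_fun, Fintype.card_fin, pow_succ]
    obtain ⟨q, hq'⟩ := Nat.exists_eq_succ_of_ne_zero hq.ne'
    rw [hq']
    simp only [Nat.succ_eq_add_one, Nat.add_sub_cancel]
    ring
  omega

/-- A hyperplane transversal to the first coordinate direction is the graph of an affine
functional. -/
theorem exists_eq_graphMap_comp {k : ℕ} {φ : (Fin k → F) →ᵃ[F] (Fin (k + 1) → F)}
    (hφ : Function.Injective φ) (h : Pi.single 0 1 ∉ LinearMap.range φ.linear) :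
    ∃ u T, φ = (graphMap u).comp T := by
  let T : (Fin k → F) →ᵃ[F] (Fin k → F) := (tailMap F k).comp φ
  have hTl : ∀ y, T.linear y = Fin.tail (φ.linear y) := fun y => rfl
  have hT : Function.Injective T := by
    rw [← T.linear_injective_iff, injective_iff_map_eq_zero]
    intro y hy
    rw [hTl] at hy
    -- A direction killed by the projection is a multiple of the first basis vector, so
    -- transversality makes it zero.
    have hy' : φ.linear y = φ.linear y 0 • Pi.single 0 1 := by
      funext i
      refine Fin.cases ?_ (fun j => ?_) i
      · simp
      · have hj : φ.linear y j.succ = 0 := congrFun hy j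
        simp [hj]
    by_cases h0 : φ.linear y 0 = 0
    · rw [h0, zero_smul] at hy'
      exact (injective_iff_map_eq_zero _).1 (φ.linear_injective_iff.2 hφ) y hy'
    · refine absurd ?_ h
      refine ⟨(φ.linear y 0)⁻¹ • y, ?_⟩
      rw [map_smul, hy']
      simp [smul_smul, h0]
  have hTb : Function.Bijective T := by
    rw [← T.linear_bijective_iff]
    exact ⟨T.linear_injective_iff.2 hT,
      LinearMap.injective_iff_surjective.1 (T.linear_injective_iff.2 hT)⟩
  let e := AffineEquiv.ofBijective hTb
  obtain ⟨u, hu⟩ := exists_eq_affineForm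
    (((headMap F k).comp φ).comp (e.symm : (Fin k → F) →ᵃ[F] (Fin k → F)))
  refine ⟨u, T, ?_⟩
  ext1 y
  have h1 : e.symm (T y) = y := e.symm_apply_apply y
  rw [AffineMap.comp_apply, graphMap_apply, ← hu]
  simp only [AffineMap.comp_apply, AffineEquiv.coe_coe, h1, headMap_apply]
  exact (Fin.cons_self_tail (φ y)).symm

/-! ### Averaging over affine automorphisms -/

/-- An injective affine endomorphism of `F^n`, as an affine automorphism. -/
noncomputable def equivOfInjective {n : ℕ} (T : (Fin n → F) →ᵃ[F] (Fin n → F))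
    (hT : Function.Injective T) : (Fin n → F) ≃ᵃ[F] (Fin n → F) :=
  AffineEquiv.ofBijective (φ := T) (T.linear_bijective_iff.1 ⟨T.linear_injective_iff.2 hT,
    LinearMap.injective_iff_surjective.1 (T.linear_injective_iff.2 hT)⟩)

@[simp]
theorem equivOfInjective_apply {n : ℕ} (T : (Fin n → F) →ᵃ[F] (Fin n → F))
    (hT : Function.Injective T) (x : Fin n → F) : equivOfInjective T hT x = T x := rfl

/-- The shear adding an affine functional of the other coordinates to the first one. -/
noncomputable def shear {k : ℕ} (u : Fin (k + 1) → F) :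
    (Fin (k + 1) → F) ≃ᵃ[F] (Fin (k + 1) → F) :=
  equivOfInjective (consMap (headMap F k + (affineForm u).comp (tailMap F k)) (tailMap F k)) <| by
    intro x y hxy
    have h := Fin.cons_injective2 (α := fun _ => F) hxy
    have ht : Fin.tail x = Fin.tail y := h.2
    have h0 : x 0 = y 0 := by simpa [ht] using h.1
    rw [← Fin.cons_self_tail x, ← Fin.cons_self_tail y, ht, h0]

theorem shear_levelMap_zero {k : ℕ} (u : Fin (k + 1) → F) (y : Fin k → F) :
    shear u (levelMap k (0 : F) y) = graphMap u y := by
  refine (equivOfInjective_apply _ _ _).trans ?_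
  simp

/-- Every injective affine map `F^k → F^{k+1}` is the restriction of an affine automorphism to
the coordinate hyperplane. -/
theorem exists_equiv_levelMap_zero {k : ℕ} {φ : (Fin k → F) →ᵃ[F] (Fin (k + 1) → F)}
    (hφ : Function.Injective φ) :
    ∃ e : (Fin (k + 1) → F) ≃ᵃ[F] (Fin (k + 1) → F),
      (e : (Fin (k + 1) → F) →ᵃ[F] (Fin (k + 1) → F)).comp (levelMap k 0) = φ := by
  have hφl : Function.Injective φ.linear := φ.linear_injective_iff.2 hφ
  have hlt : LinearMap.range φ.linear < ⊤ := lt_top_iff_ne_top.2 fun h => by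
    have := LinearMap.finrank_range_le φ.linear
    rw [h, finrank_top] at this
    simp at this
  obtain ⟨v, -, hv⟩ := SetLike.exists_of_lt hlt
  let T : (Fin (k + 1) → F) →ᵃ[F] (Fin (k + 1) → F) :=
    φ.comp (tailMap F k) +
      ((LinearMap.proj 0 : (Fin (k + 1) → F) →ₗ[F] F).smulRight v).toAffineMap
  have hTl : ∀ x, T.linear x = φ.linear (Fin.tail x) + x 0 • v := fun x => by
    simp [T]; rfl
  have hT : Function.Injective T := by
    rw [← T.linear_injective_iff, injective_iff_map_eq_zero]
    intro x hx
    rw [hTl] at hx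
    have h0 : x 0 = 0 := by
      by_contra h0
      refine hv ⟨-(x 0)⁻¹ • Fin.tail x, ?_⟩
      rw [map_smul, eq_neg_of_add_eq_zero_left hx]
      simp [smul_smul, h0]
    rw [h0, zero_smul, add_zero] at hx
    have h1 := (injective_iff_map_eq_zero _).1 hφl _ hx
    rw [← Fin.cons_self_tail x, h0, h1]
    exact funext (Fin.cases rfl fun _ => rfl)
  refine ⟨equivOfInjective T hT, ?_⟩
  ext1 y
  simp [T]

instance finite_affineEquiv [Finite F] {n : ℕ} :
    Finite ((Fin n → F) ≃ᵃ[F] (Fin n → F)) :=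
  Finite.of_injective (fun e : (Fin n → F) ≃ᵃ[F] (Fin n → F) => (e : (Fin n → F) → (Fin n → F)))
    DFunLike.coe_injective

instance finite_affineSubspace [Finite F] {n : ℕ} : Finite (AffineSubspace F (Fin n → F)) :=
  Finite.of_injective (fun A => (A : Set (Fin n → F))) SetLike.coe_injective

/-- If a function violates the code on some hyperplane, then at least a `1 / |F|` fraction of
the affine images of the coordinate hyperplane violate it. -/
theorem card_affineEquiv_le [Fintype F] {k : ℕ} {D : Submodule F ((Fin k → F) → F)}
    (hD : IsAffineInvariant D) {f : (Fin (k + 1) → F) → F}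
    {φ : (Fin k → F) →ᵃ[F] (Fin (k + 1) → F)} (hφ : Function.Injective φ) (h : f ∘ φ ∉ D) :
    Nat.card ((Fin (k + 1) → F) ≃ᵃ[F] (Fin (k + 1) → F)) ≤
      Fintype.card F * Nat.card {e : (Fin (k + 1) → F) ≃ᵃ[F] (Fin (k + 1) → F) //
        f ∘ e ∘ levelMap k (0 : F) ∉ D} := by
  classical
  let G := (Fin (k + 1) → F) ≃ᵃ[F] (Fin (k + 1) → F)
  let _ : Fintype G := Fintype.ofFinite G
  have hgraph : ∀ e : G, Fintype.card F ^ k ≤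
      (Finset.univ.filter fun u : Fin (k + 1) → F => f ∘ (e * shear u : G) ∘ levelMap k (0 : F) ∉ D).card := by
    intro e
    -- If all graphs were good for `f ∘ e`, so would be all hyperplanes transversal to the first
    -- axis, hence all hyperplanes.
    have hex : ∃ u : Fin (k + 1) → F, (f ∘ e) ∘ graphMap u ∉ D := by
      by_contra! hall
      have hv : (Pi.single 0 1 : Fin (k + 1) → F) ≠ 0 := by simp
      have := forall_comp_mem_of_forall_transversal hD (Nat.lt_succ_self k) (f := f ∘ e) hv
        (fun ψ hψ hr => by
          obtain ⟨u, T, rfl⟩ := exists_eq_graphMap_comp hψ hr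
          exact hD _ (hall u) T)
        ((e.symm : (Fin (k + 1) → F) →ᵃ[F] (Fin (k + 1) → F)).comp φ)
        (e.symm.injective.comp hφ)
      refine h ?_
      convert this using 1
      funext y
      exact congrArg f (AffineEquiv.apply_symm_apply e (φ y)).symm
    obtain ⟨u, hu⟩ := hex
    have hle := card_pow_le_card_graph_notMem hu
    rw [Nat.card_eq_fintype_card, Fintype.card_subtype] at hle
    have hcomp : ∀ u : Fin (k + 1) → F,
        f ∘ (e * shear u : G) ∘ levelMap k (0 : F) = (f ∘ e) ∘ graphMap u := fun u =>
      funext fun y => congrArg (f ∘ e) (shear_levelMap_zero u y)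
    simpa only [hcomp] using hle
  have hshift : ∀ u : Fin (k + 1) → F,
      (Finset.univ.filter fun e : G => f ∘ (e * shear u : G) ∘ levelMap k (0 : F) ∉ D).card =
        Nat.card {e : G // f ∘ e ∘ levelMap k (0 : F) ∉ D} := by
    intro u
    rw [Nat.card_eq_fintype_card, Fintype.card_subtype]
    exact Finset.card_equiv (Equiv.mulRight (shear u)) fun e => by simp
  -- Double count the bad pairs `(e, u)`: at least `q ^ k` for each `e`, and the same number for
  -- each `u` since right translation by a shear is a bijection.
  have hcount := Finset.sum_card_bipartiteAbove_eq_sum_card_bipartiteBelow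
    (s := (Finset.univ : Finset G)) (t := (Finset.univ : Finset (Fin (k + 1) → F)))
    (fun e u => f ∘ (e * shear u : G) ∘ levelMap k (0 : F) ∉ D)
  simp only [Finset.bipartiteAbove, Finset.bipartiteBelow, hshift] at hcount
  rw [Finset.sum_const, Finset.card_univ, Fintype.card_fun, Fintype.card_fin, smul_eq_mul] at hcount
  have hsum := Finset.sum_le_sum fun (e : G) (_ : e ∈ Finset.univ) => hgraph e
  rw [hcount, Finset.sum_const, Finset.card_univ, smul_eq_mul] at hsum
  rw [Nat.card_eq_fintype_card]
  refine Nat.le_of_mul_le_mul_right (hsum.trans_eq ?_) (pow_pos (Fintype.card_pos (α := F)) k)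
  ring

/-- The image of the coordinate hyperplane under an affine automorphism. -/
noncomputable def imageHyperplane {k : ℕ} (e : (Fin (k + 1) → F) ≃ᵃ[F] (Fin (k + 1) → F)) :
    AffineSubspace F (Fin (k + 1) → F) :=
  (⊤ : AffineSubspace F (Fin k → F)).map
    ((e : (Fin (k + 1) → F) →ᵃ[F] (Fin (k + 1) → F)).comp (levelMap k 0))

theorem isFlat_imageHyperplane {k : ℕ} (e : (Fin (k + 1) → F) ≃ᵃ[F] (Fin (k + 1) → F)) :
    IsFlat k (imageHyperplane e) :=
  isFlat_map_top (e.injective.comp (levelMap_injective 0))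

theorem exists_imageHyperplane_eq {k : ℕ} {H : AffineSubspace F (Fin (k + 1) → F)}
    (hH : IsFlat k H) : ∃ e, imageHyperplane e = H := by
  obtain ⟨φ, hφ, rfl⟩ := hH.exists_eq_map_top
  obtain ⟨e, rfl⟩ := exists_equiv_levelMap_zero hφ
  exact ⟨e, rfl⟩

theorem imageHyperplane_mul {k : ℕ} (g e : (Fin (k + 1) → F) ≃ᵃ[F] (Fin (k + 1) → F)) :
    imageHyperplane (g * e) =
      (imageHyperplane e).map (g : (Fin (k + 1) → F) →ᵃ[F] (Fin (k + 1) → F)) := by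
  rw [imageHyperplane, imageHyperplane, AffineSubspace.map_map]
  rfl

/-- All hyperplanes arise from the same number of affine automorphisms. -/
theorem card_imageHyperplane_mem [Finite F] {k : ℕ}
    {X : Set (AffineSubspace F (Fin (k + 1) → F))} (hX : ∀ H ∈ X, IsFlat k H) :
    Nat.card {e : (Fin (k + 1) → F) ≃ᵃ[F] (Fin (k + 1) → F) // imageHyperplane e ∈ X} =
      X.ncard * Nat.card {e : (Fin (k + 1) → F) ≃ᵃ[F] (Fin (k + 1) → F) //
        imageHyperplane e = imageHyperplane 1} := by
  classical
  let G := (Fin (k + 1) → F) ≃ᵃ[F] (Fin (k + 1) → F)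
  let _ : Fintype G := Fintype.ofFinite G
  let _ : Fintype (AffineSubspace F (Fin (k + 1) → F)) := Fintype.ofFinite _
  rw [Nat.card_eq_fintype_card, Fintype.card_subtype, Nat.card_eq_fintype_card,
    Fintype.card_subtype, Set.ncard_eq_toFinset_card',
    Finset.card_eq_sum_card_fiberwise (f := imageHyperplane) (t := X.toFinset)
      (fun e he => by simpa using he), ← smul_eq_mul, ← Finset.sum_const]
  refine Finset.sum_congr rfl fun H hH => ?_
  obtain ⟨g, rfl⟩ := exists_imageHyperplane_eq (hX H (by simpa using hH))
  -- Left translation by `g` carries the fibre over the coordinate hyperplane onto the fibre over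
  -- its image under `g`.
  refine (Finset.card_equiv (Equiv.mulLeft g) fun e => ?_).symm
  have hinj : Function.Injective (AffineSubspace.map
      (g : (Fin (k + 1) → F) →ᵃ[F] (Fin (k + 1) → F))) := by
    intro A B hAB
    refine SetLike.coe_injective (g.injective.image_injective ?_)
    exact congrArg (fun A : AffineSubspace F (Fin (k + 1) → F) => (A : Set (Fin (k + 1) → F))) hAB
  have hiff : imageHyperplane (g * e) = imageHyperplane g ↔
      imageHyperplane e = imageHyperplane 1 := by
    rw [← hinj.eq_iff (a := imageHyperplane e), ← imageHyperplane_mul, ← imageHyperplane_mul,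
      mul_one]
  simp only [Finset.mem_filter, Finset.mem_univ, true_and, Equiv.coe_mulLeft, hiff]
  refine ⟨fun h => ⟨?_, h⟩, fun h => h.2⟩
  rw [hiff.2 h]
  simpa using hH

/-! ### The lower bound and the correction -/

/-- Equal fibres of `imageHyperplane` turn the count of automorphisms in `card_affineEquiv_le` into
a count of hyperplanes. -/
theorem one_div_card_le_rejectProb [Fintype F] {t k : ℕ} (htk : t ≤ k)
    {B : Submodule F ((Fin t → F) → F)} (hB : IsAffineInvariant B) {f : (Fin (k + 1) → F) → F}
    (hf : f ∉ lift B (k + 1)) : 1 / (Fintype.card F : ℚ) ≤ rejectProb B k f := by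
  have hD := isAffineInvariant_liftCode htk hB
  rw [mem_lift_iff_forall_comp_mem_liftCode htk (Nat.le_succ k) hB] at hf
  push Not at hf
  obtain ⟨φ, hφ, h⟩ := hf
  have hle := card_affineEquiv_le hD hφ h
  have hbad := card_imageHyperplane_mem (X := badFlats B k f) fun H hH => hH.1
  have hall := card_imageHyperplane_mem
    (X := {A : AffineSubspace F (Fin (k + 1) → F) | IsFlat k A}) fun H hH => hH
  have hbad_iff : ∀ e : (Fin (k + 1) → F) ≃ᵃ[F] (Fin (k + 1) → F),
      imageHyperplane e ∈ badFlats B k f ↔ f ∘ e ∘ levelMap k (0 : F) ∉ liftCode B k := fun e =>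
    ⟨fun he hmem => he.2 ((restrictsInto_map_top_iff hD
      (e.injective.comp (levelMap_injective 0))).2 hmem),
    fun he => ⟨isFlat_imageHyperplane e, fun hr => he ((restrictsInto_map_top_iff hD
      (e.injective.comp (levelMap_injective 0))).1 hr)⟩⟩
  rw [Nat.card_congr (Equiv.subtypeEquivRight hbad_iff)] at hbad
  rw [Nat.card_congr (Equiv.subtypeUnivEquiv
    (p := fun e => imageHyperplane e ∈ {A : AffineSubspace F (Fin (k + 1) → F) | IsFlat k A})
    fun e => isFlat_imageHyperplane e)] at hall
  rw [hbad, hall] at hle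
  set M := Nat.card {e : (Fin (k + 1) → F) ≃ᵃ[F] (Fin (k + 1) → F) //
    imageHyperplane e = imageHyperplane 1}
  have hM : 0 < M := by
    have : Nonempty {e : (Fin (k + 1) → F) ≃ᵃ[F] (Fin (k + 1) → F) //
      imageHyperplane e = imageHyperplane 1} := ⟨⟨1, rfl⟩⟩
    exact Nat.card_pos
  rw [← mul_assoc] at hle
  have hle' := Nat.le_of_mul_le_mul_right hle hM
  have hpos : 0 < {A : AffineSubspace F (Fin (k + 1) → F) | IsFlat k A}.ncard :=
    (Set.ncard_pos (Set.toFinite _)).2 ⟨_, isFlat_imageHyperplane 1⟩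
  have hq : 0 < Fintype.card F := Fintype.card_pos
  rw [rejectProb, div_le_div_iff₀ (by exact_mod_cast hq) (by exact_mod_cast hpos), one_mul,
    mul_comm]
  exact_mod_cast hle'

/-- A function all of whose bad hyperplanes are exactly those through `x` can be corrected by
changing its value at `x`. -/
theorem exists_mem_lift_eq_iff_ne [Fintype F] {t k : ℕ} (htk : t ≤ k)
    {B : Submodule F ((Fin t → F) → F)} (hB : IsAffineInvariant B) {f : (Fin (k + 1) → F) → F}
    (hf : f ∉ lift B (k + 1)) (hprob : rejectProb B k f = 1 / (Fintype.card F : ℚ))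
    {x : Fin (k + 1) → F} (hx : badFlats B k f = {H | IsFlat k H ∧ x ∈ H}) :
    ∃ g ∈ lift B (k + 1), ∀ z, g z = f z ↔ z ≠ x := by
  classical
  have hD := isAffineInvariant_liftCode htk hB
  have hgood : ∀ φ : (Fin k → F) →ᵃ[F] (Fin (k + 1) → F), Function.Injective φ →
      x ∉ Set.range φ → f ∘ φ ∈ liftCode B k := by
    intro φ hφ hxφ
    by_contra hmem
    have hbad : (⊤ : AffineSubspace F (Fin k → F)).map φ ∈ badFlats B k f :=
      ⟨isFlat_map_top hφ, fun hr => hmem ((restrictsInto_map_top_iff hD hφ).1 hr)⟩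
    rw [hx] at hbad
    obtain ⟨y, -, hy⟩ := hbad.2
    exact hxφ ⟨y, hy⟩
  -- Translate `x` to the origin.
  obtain ⟨c, hc⟩ := exists_sub_single_mem hD (f := fun z => f (z + x)) fun φ hφ h0 => by
    exact hgood (φ + AffineMap.const F (Fin k → F) x) (fun y z hyz => hφ (by simpa using hyz)) (by
      rintro ⟨y, hy⟩
      exact h0 ⟨y, by simpa using hy⟩)
  let g : (Fin (k + 1) → F) → F := f - Pi.single x c
  have hne : ∀ z, z ≠ x → g z = f z := fun z hz => by simp [g, hz]
  have hg : g ∈ lift B (k + 1) := by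
    by_contra hg
    have hle := one_div_card_le_rejectProb htk hB hg
    let ψ : (Fin k → F) →ᵃ[F] (Fin (k + 1) → F) := levelMap k 0 + AffineMap.const F _ x
    have hψ : Function.Injective ψ := fun y z hyz =>
      levelMap_injective (0 : F) (by simpa [ψ] using hyz)
    have hgψ : g ∘ ψ ∈ liftCode B k := by
      convert hc using 1
      funext y
      have : (Fin.cons 0 y : Fin (k + 1) → F) = 0 ↔ y = 0 := by
        constructor
        · intro h
          exact congrArg Fin.tail h
        · rintro rfl
          exact funext (Fin.cases rfl fun _ => rfl)
      simp [g, ψ, Pi.single_apply, this]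
    -- Hyperplanes missing `x` do not see the change, and the range of `ψ`, which passes through
    -- `x`, has become good.
    have hss : badFlats B k g ⊂ badFlats B k f := by
      rw [Set.ssubset_iff_of_subset]
      · refine ⟨(⊤ : AffineSubspace F (Fin k → F)).map ψ, ?_, fun hbad =>
          hbad.2 ((restrictsInto_map_top_iff hD hψ).2 hgψ)⟩
        rw [hx]
        exact ⟨isFlat_map_top hψ, 0, trivial, by
          have : (Fin.cons 0 0 : Fin (k + 1) → F) = 0 := funext (Fin.cases rfl fun _ => rfl)
          simp [ψ, this]⟩
      · rintro H ⟨hH, hr⟩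
        rw [hx]
        refine ⟨hH, ?_⟩
        by_contra hxH
        obtain ⟨φ, hφ, rfl⟩ := hH.exists_eq_map_top
        have hxφ : x ∉ Set.range φ := fun ⟨y, hy⟩ => hxH ⟨y, trivial, hy⟩
        refine hr ((restrictsInto_map_top_iff hD hφ).2 ?_)
        convert hgood φ hφ hxφ using 1
        funext y
        exact hne _ fun h => hxφ ⟨y, h⟩
    have hlt := Set.ncard_lt_ncard hss
    have hpos : 0 < {A : AffineSubspace F (Fin (k + 1) → F) | IsFlat k A}.ncard :=
      (Set.ncard_pos (Set.toFinite _)).2 ⟨_, isFlat_imageHyperplane 1⟩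
    have : rejectProb B k g < rejectProb B k f := by
      unfold rejectProb
      gcongr
    exact absurd hle (not_le.2 (hprob ▸ this))
  refine ⟨g, hg, fun z => ⟨?_, hne z⟩⟩
  rintro hz rfl
  -- Agreement at `x` too would make `g = f`, contradicting `hf`.
  have hc0 : c = 0 := by simpa [g] using hz
  exact hf (by simpa [g, hc0] using hg)

end LiftedCode

theorem lemma13 {F : Type*} [Field F] [Fintype F] {t k : ℕ} (htk : t ≤ k)
    (B : Submodule F ((Fin t → F) → F)) (hB : LiftedCode.IsAffineInvariant B)
    (f : (Fin (k + 1) → F) → F) (hf : f ∉ LiftedCode.lift B (k + 1)) :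
    1 / (Fintype.card F : ℚ) ≤ LiftedCode.rejectProb B k f ∧
    (LiftedCode.rejectProb B k f = 1 / (Fintype.card F : ℚ) →
      ∀ xstar : Fin (k + 1) → F,
        LiftedCode.badFlats B k f =
          {H : AffineSubspace F (Fin (k + 1) → F) | LiftedCode.IsFlat k H ∧ xstar ∈ H} →
        ∃ g ∈ LiftedCode.lift B (k + 1), ∀ x, g x = f x ↔ x ≠ xstar) :=
  ⟨LiftedCode.one_div_card_le_rejectProb htk hB hf, fun hprob _ hx =>
    LiftedCode.exists_mem_lift_eq_iff_ne htk hB hf hprob hx⟩
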